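/- Let $(A,\mathfrak m)$ be a one-dimensional Cohen--Macaulay (Noetherian) local ring with infinite residue field, and let $x\in\mathfrak m$ be such that $xA$ is a minimal reduction of $\mathfrak m$. Let $r$ be the reduction number, i.e. the least integer $r\ge 0$ with $\mathfrak m^{r+1}=x\mathfrak m^r$. Let $\lambda$ denote length and $\mu$ the minimal number of generators of an $A$-module, and let $G(\mathfrak m)=\bigoplus_{n\ge 0}\mathfrak m^n/\mathfrak m^{n+1}$ be the tangent cone. (a) Let $F(x)=\bigoplus_{n\ge0}x^nA/x^n\mathfrak m$, let $x^*\in F(x)$ be the class of $x$ in degree one, and regard $G(\mathfrak m)$ as a graded $F(x)$-module via the canonical map $F(x)\to G(\mathfrak m)$. The invariants $\alpha_i$ ($0\le i\le r$), together with $\alpha_{i,j}$ ($1\le i\le r-1$, $1\le j\le r-i$), of the tangent cone with respect to $x$ are the non-negative integers for which there is an isomorphism of graded $F(x)$-modules $$G(\mathfrak m)\cong\bigoplus_{i=0}^{r}\bigl(F(x)(-i)\bigr)^{\alpha_i}\oplus\bigoplus_{i=1}^{r-1}\bigoplus_{j=1}^{r-i}\Bigl(\frac{F(x)}{(x^*)^jF(x)}(-i)\Bigr)^{\alpha_{i,j}}.$$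 (b) Let $A'$ be the first neighborhood ring of $A$, i.e. the subring of the total ring of fractions of $A$ consisting of all fractions $b/a$ for which there is an $s\ge 0$ such that $b\in\mathfrak m^s$ and $a$ is superficial of degree $s$ (that is, $a\in\mathfrak m^s$ and $\mathfrak m^{n+s}=a\mathfrak m^n$ for all large $n$). The micro-invariants of $A$ are, for $1\le i\le r$, $$\beta_i=\lambda\left(\frac{A+\mathfrak m^{i-1}A'}{A+\mathfrak m^{i}A'}\right)-\lambda\left(\frac{A+\mathfrak m^{i}A'}{A+\mathfrak m^{i+1}A'}\right).$$ (c) The Apery invariants of $A$ with respect to $x$ are, for $1\le i\le r$, $$\gamma_i=\lambda\left(\frac{\mathfrak m^i+xA}{\mathfrak m^{i+1}+xA}\right).$$ Assume that at least one of the following three conditions holds: (1) $\alpha_i=\mu(\mathfrak m^i)-\mu(\mathfrak m^{i-1})$ for all $1\le i\le r$; (2) $\beta_i=\mu(\mathfrak m^i)-\mu(\mathfrak m^{i-1})$ for all $1\le i\le r$; (3) $\gamma_i=\mu(\mathfrak m^i)-\mu(\mathfrak m^{i-1})$ for all $1\le i\le r$. Then $G(\mathfrak m)$ is a Cohen--Macaulay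 ring. -/

import Mathlib

open scoped DirectSum

noncomputable section

/-! ### Cohen–Macaulay rings -/

/-- A local ring is Cohen–Macaulay if it is Noetherian and its maximal ideal contains a regular
sequence whose length is the Krull dimension of the ring (that is, depth equals dimension). -/
def IsCohenMacaulayLocalRing (R : Type*) [CommRing R] [IsLocalRing R] : Prop :=
  IsNoetherianRing R ∧ ∃ rs : List R, (∀ a ∈ rs, a ∈ IsLocalRing.maximalIdeal R) ∧
    RingTheory.Sequence.IsRegular R rs ∧ ((rs.length : ℕ) : WithBot ℕ∞) = ringKrullDim R

/-- A commutative ring is Cohen–Macaulay if it is Noetherian and all its localizations at maximal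
ideals are Cohen–Macaulay local rings. -/
def IsCohenMacaulayRing (R : Type*) [CommRing R] : Prop :=
  IsNoetherianRing R ∧ ∀ (p : Ideal R) [p.IsMaximal],
    IsCohenMacaulayLocalRing (Localization.AtPrime p)

/-! ### Reductions, lengths -/

/-- `J` is a reduction of `I`. -/
def Ideal.IsReductionOf {R : Type*} [CommRing R] (J I : Ideal R) : Prop :=
  J ≤ I ∧ ∃ n : ℕ, I ^ (n + 1) = J * I ^ n

/-- `J` is a minimal reduction of `I`: it is minimal, for inclusion, among the reductions of `I`. -/
def Ideal.IsMinimalReductionOf {R : Type*} [CommRing R] (J I : Ideal R) : Prop :=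
  Minimal (fun K : Ideal R => K.IsReductionOf I) J

/-- The reduction number of `I` with respect to `J`: the least `n` with `I ^ (n + 1) = J I ^ n`. -/
def Ideal.reductionNumber {R : Type*} [CommRing R] (J I : Ideal R) : ℕ :=
  sInf {n : ℕ | I ^ (n + 1) = J * I ^ n}

/-- The length of `P / N`, for submodules `N ≤ P` with quotient of finite length. -/
def Submodule.relLength {R M : Type*} [CommRing R] [AddCommGroup M] [Module R M]
    (N P : Submodule R M) : ℕ :=
  (Module.length R (P ⧸ N.submoduleOf P)).toNat

/-! ### The graded rings `⨁ J ^ n / I J ^ n` -/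

/-- The `R`-module `J ^ n / I J ^ n`. -/
def FiberConePiece {R : Type*} [CommRing R] (I J : Ideal R) (n : ℕ) : Type _ :=
  ↥(J ^ n) ⧸ (I * J ^ n).submoduleOf (J ^ n)

namespace FiberConePiece

variable {R : Type*} [CommRing R] (I J : Ideal R)

instance (n : ℕ) : AddCommGroup (FiberConePiece I J n) :=
  inferInstanceAs (AddCommGroup (↥(J ^ n) ⧸ (I * J ^ n).submoduleOf (J ^ n)))

instance (n : ℕ) : Module R (FiberConePiece I J n) :=
  inferInstanceAs (Module R (↥(J ^ n) ⧸ (I * J ^ n).submoduleOf (J ^ n)))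

/-- The class in `J ^ n / I J ^ n` of an element of `J ^ n`. -/
def mk (n : ℕ) : ↥(J ^ n) →ₗ[R] FiberConePiece I J n :=
  ((I * J ^ n).submoduleOf (J ^ n)).mkQ

theorem mk_surjective (n : ℕ) : Function.Surjective (mk I J n) :=
  Submodule.mkQ_surjective _

theorem mk_eq_zero_iff (n : ℕ) (a : ↥(J ^ n)) : mk I J n a = 0 ↔ (a : R) ∈ I * J ^ n :=
  Submodule.Quotient.mk_eq_zero _

/-- The multiplication `J ^ i × J ^ j → J ^ (i + j)`. -/
def powMul (i j : ℕ) : ↥(J ^ i) →ₗ[R] ↥(J ^ j) →ₗ[R] ↥(J ^ (i + j)) :=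
  LinearMap.mk₂ R (fun a b => ⟨(a : R) * b, pow_add J i j ▸ Ideal.mul_mem_mul a.2 b.2⟩)
    (fun _ _ _ => Subtype.ext (add_mul _ _ _)) (fun _ _ _ => Subtype.ext (mul_assoc _ _ _))
    (fun _ _ _ => Subtype.ext (mul_add _ _ _)) (fun _ _ _ => Subtype.ext (mul_left_comm _ _ _))

/-- The multiplication `J ^ i / I J ^ i × J ^ j / I J ^ j → J ^ (i + j) / I J ^ (i + j)` induced by
that of `R`; see `mulMap_mk`. -/
def mulMap (i j : ℕ) :
    FiberConePiece I J i →ₗ[R] FiberConePiece I J j →ₗ[R] FiberConePiece I J (i + j) :=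
  Submodule.liftQ _
    (LinearMap.flip (Submodule.liftQ _ ((powMul J i j).compr₂ (mk I J (i + j))).flip (by
      intro b hb
      rw [LinearMap.mem_ker]
      ext a
      refine (mk_eq_zero_iff I J _ _).2 ?_
      have hb' : (b : R) ∈ I * J ^ j := hb
      have := Ideal.mul_mem_mul a.2 hb'
      rwa [mul_left_comm, ← pow_add] at this))) (by
    intro a ha
    rw [LinearMap.mem_ker]
    ext b
    obtain ⟨b, rfl⟩ := mk_surjective I J j b
    refine (mk_eq_zero_iff I J _ _).2 ?_
    have ha' : (a : R) ∈ I * J ^ i := ha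
    have := Ideal.mul_mem_mul ha' b.2
    rwa [mul_assoc, ← pow_add] at this)

theorem mulMap_mk (i j : ℕ) (a : ↥(J ^ i)) (b : ↥(J ^ j)) :
    mulMap I J i j (mk I J i a) (mk I J j b) = mk I J (i + j) (powMul J i j a b) := rfl

theorem sigma_ext {i j : ℕ} (h : i = j) (a : ↥(J ^ i)) (b : ↥(J ^ j)) (hab : (a : R) = b) :
    (⟨i, mk I J i a⟩ : GradedMonoid (FiberConePiece I J)) = ⟨j, mk I J j b⟩ := by
  subst h
  rw [Subtype.ext hab]

instance : GradedMonoid.GOne (FiberConePiece I J) where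
  one := mk I J 0 ⟨1, by simp⟩

instance : GradedMonoid.GMul (FiberConePiece I J) where
  mul {i j} a b := mulMap I J i j a b

instance : DirectSum.GCommRing (FiberConePiece I J) where
  mul_zero {i j} a := map_zero (mulMap I J i j a)
  zero_mul {i j} b := by
    change mulMap I J i j 0 b = 0
    rw [map_zero, LinearMap.zero_apply]
  mul_add {i j} a b c := map_add (mulMap I J i j a) b c
  add_mul {i j} a b c := by
    change mulMap I J i j (a + b) c = mulMap I J i j a c + mulMap I J i j b c
    rw [map_add, LinearMap.add_apply]
  one_mul := by
    rintro ⟨i, a⟩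
    obtain ⟨a, rfl⟩ := mk_surjective I J i a
    exact sigma_ext I J (zero_add i) _ _ (one_mul _)
  mul_one := by
    rintro ⟨i, a⟩
    obtain ⟨a, rfl⟩ := mk_surjective I J i a
    exact sigma_ext I J (add_zero i) _ _ (mul_one _)
  mul_assoc := by
    rintro ⟨i, a⟩ ⟨j, b⟩ ⟨k, c⟩
    obtain ⟨a, rfl⟩ := mk_surjective I J i a
    obtain ⟨b, rfl⟩ := mk_surjective I J j b
    obtain ⟨c, rfl⟩ := mk_surjective I J k c
    exact sigma_ext I J (add_assoc i j k) _ _ (mul_assoc _ _ _)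
  mul_comm := by
    rintro ⟨i, a⟩ ⟨j, b⟩
    obtain ⟨a, rfl⟩ := mk_surjective I J i a
    obtain ⟨b, rfl⟩ := mk_surjective I J j b
    exact sigma_ext I J (add_comm i j) _ _ (mul_comm _ _)
  natCast n := n • mk I J 0 ⟨1, by simp⟩
  natCast_zero := zero_smul ℕ _
  natCast_succ n := succ_nsmul _ n
  intCast n := n • mk I J 0 ⟨1, by simp⟩
  intCast_ofNat n := natCast_zsmul _ n
  intCast_negSucc_ofNat n := by
    rw [Int.negSucc_eq, neg_smul]
    rw [← natCast_zsmul _ (n + 1)]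
    rfl

/-- The class of a product is the product of the classes. -/
theorem gMul_mk (i j : ℕ) (a : ↥(J ^ i)) (b : ↥(J ^ j)) :
    GradedMonoid.GMul.mul (mk I J i a) (mk I J j b) = mk I J (i + j) (powMul J i j a b) := rfl

variable {J} {K : Ideal R}

/-- The map `J ^ n / I J ^ n → K ^ n / I K ^ n` induced by the inclusion, for `J ≤ K`. -/
def map (h : J ≤ K) (n : ℕ) : FiberConePiece I J n →ₗ[R] FiberConePiece I K n :=
  Submodule.mapQ _ _ (Submodule.inclusion (Ideal.pow_right_mono h n)) (by
    intro a ha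
    have ha' : (a : R) ∈ I * J ^ n := ha
    exact Ideal.mul_mono_right (Ideal.pow_right_mono h n) ha')

end FiberConePiece

/-- The direct sum `⨁ n, J ^ n / I J ^ n`. Its ring structure is induced by the multiplication
of `R`. -/
abbrev FiberCone {R : Type*} [CommRing R] (I J : Ideal R) : Type _ :=
  ⨁ n : ℕ, FiberConePiece I J n

/-- The homomorphism of graded rings `⨁ J ^ n / I J ^ n → ⨁ K ^ n / I K ^ n` induced by the
inclusions `J ^ n ⊆ K ^ n`, for `J ≤ K`. -/
def FiberCone.map {R : Type*} [CommRing R] (I : Ideal R) {J K : Ideal R} (h : J ≤ K) :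
    FiberCone I J →+* FiberCone I K :=
  DirectSum.toSemiring
    (fun n => (DirectSum.of (FiberConePiece I K) n).comp
      (FiberConePiece.map I h n).toAddMonoidHom)
    rfl
    (by
      intro i j a b
      obtain ⟨a, rfl⟩ := FiberConePiece.mk_surjective I J i a
      obtain ⟨b, rfl⟩ := FiberConePiece.mk_surjective I J j b
      change DirectSum.of (FiberConePiece I K) (i + j) _ =
        DirectSum.of (FiberConePiece I K) i _ * DirectSum.of (FiberConePiece I K) j _
      rw [DirectSum.of_mul_of]
      rfl)

/-! ### The tangent cone and its invariants -/

section TangentCone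

variable (A : Type*) [CommRing A] [IsLocalRing A]

/-- The tangent cone `G(m) = ⨁ m ^ n / m ^ (n + 1)` (note that `m * m ^ n = m ^ (n + 1)`). -/
abbrev TangentCone : Type _ :=
  FiberCone (IsLocalRing.maximalIdeal A) (IsLocalRing.maximalIdeal A)

variable {A}

/-- The graded ring `F(x) = ⨁ x ^ n A / x ^ n m`. -/
abbrev NoetherNormalization (x : A) : Type _ :=
  FiberCone (IsLocalRing.maximalIdeal A) (Ideal.span {x})

/-- The element `x*` of `F(x)`: the class of `x` in degree one. -/
def NoetherNormalization.xStar (x : A) : NoetherNormalization x :=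
  DirectSum.of (FiberConePiece (IsLocalRing.maximalIdeal A) (Ideal.span {x})) 1
    (FiberConePiece.mk _ _ 1 ⟨x, by rw [pow_one]; exact Ideal.mem_span_singleton_self x⟩)

/-- The cyclic module `F(x) / (x*) ^ j F(x)`. -/
abbrev NoetherNormalization.Truncation (x : A) (j : ℕ) : Type _ :=
  NoetherNormalization x ⧸ Ideal.span {NoetherNormalization.xStar x ^ j}

/-- The homogeneous component of degree `n` of the shifted module `F(x)(-i)`, that is, the
component of degree `n - i` of `F(x)` (which is zero if `n < i`). -/
def NoetherNormalization.shiftedPiece (x : A) (i n : ℕ) : Set (NoetherNormalization x) :=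
  {f | ∀ k : ℕ, k + i ≠ n → f k = 0}

/-- The reduction number of `m` with respect to `xA`. -/
def redNum (x : A) : ℕ :=
  Ideal.reductionNumber (Ideal.span {x}) (IsLocalRing.maximalIdeal A)

/-- Index set of the free summands: `α i` copies for every `0 ≤ i ≤ r`. -/
abbrev FreeIndex (r : ℕ) (α : ℕ → ℕ) : Type :=
  Σ i : {i : ℕ // i ≤ r}, Fin (α i)

/-- Index set of the torsion summands: `αt i j` copies for every `1 ≤ i ≤ r - 1` and
`1 ≤ j ≤ r - i`. -/
abbrev TorsionIndex (r : ℕ) (αt : ℕ → ℕ → ℕ) : Type :=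
  Σ p : {p : ℕ × ℕ // 1 ≤ p.1 ∧ p.1 ≤ r - 1 ∧ 1 ≤ p.2 ∧ p.2 ≤ r - p.1}, Fin (αt p.1.1 p.1.2)

/-- The `F(x)`-module
`⨁_{i=0}^r F(x)(-i)^(α i) ⊕ ⨁_{i=1}^{r-1} ⨁_{j=1}^{r-i} (F(x)/(x*)^j F(x))(-i)^(αt i j)`. -/
abbrev CyclicSum (x : A) (α : ℕ → ℕ) (αt : ℕ → ℕ → ℕ) : Type _ :=
  (⨁ _ : FreeIndex (redNum x) α, NoetherNormalization x) ×
    (⨁ s : TorsionIndex (redNum x) αt, NoetherNormalization.Truncation x s.1.1.2)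

/-- The homogeneous component of degree `n` of the module `CyclicSum x α αt`. -/
def CyclicSum.piece (x : A) (α : ℕ → ℕ) (αt : ℕ → ℕ → ℕ) (n : ℕ) : Set (CyclicSum x α αt) :=
  {v | (∀ s, v.1 s ∈ NoetherNormalization.shiftedPiece x s.1.1 n) ∧
    ∀ s, ∃ f ∈ NoetherNormalization.shiftedPiece x s.1.1.1 n, v.2 s = Ideal.Quotient.mk _ f}

/-- `α i` and `αt i j` are the invariants of the tangent cone with respect to `x`: there is an
isomorphism of graded `F(x)`-modules
`⨁_{i=0}^r F(x)(-i)^(α i) ⊕ ⨁_{i=1}^{r-1} ⨁_{j=1}^{r-i} (F(x)/(x*)^j F(x))(-i)^(αt i j) ≅ G(m)`,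
where `F(x)` acts on `G(m)` through the canonical map `F(x) → G(m)`. -/
def IsTangentConeInvariants (x : A) (hx : Ideal.span {x} ≤ IsLocalRing.maximalIdeal A)
    (α : ℕ → ℕ) (αt : ℕ → ℕ → ℕ) : Prop :=
  ∃ e : CyclicSum x α αt ≃+ TangentCone A,
    (∀ (f : NoetherNormalization x) (v : CyclicSum x α αt),
      e (f • v) = FiberCone.map (IsLocalRing.maximalIdeal A) hx f * e v) ∧
    ∀ n, ∀ v ∈ CyclicSum.piece x α αt n, ∀ k, k ≠ n → e v k = 0

end TangentCone

/-! ### The first neighborhood ring, micro-invariants and Apery invariants -/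

section Invariants

variable {A : Type*} [CommRing A] [IsLocalRing A]

/-- `a` is superficial of degree `s`: `a ∈ m ^ s` and `m ^ (n + s) = a m ^ n` for all large `n`. -/
def IsSuperficial (a : A) (s : ℕ) : Prop :=
  a ∈ IsLocalRing.maximalIdeal A ^ s ∧ ∃ N : ℕ, ∀ n ≥ N,
    IsLocalRing.maximalIdeal A ^ (n + s) = Ideal.span {a} * IsLocalRing.maximalIdeal A ^ n

theorem IsSuperficial.mul {a b : A} {s t : ℕ} (ha : IsSuperficial a s) (hb : IsSuperficial b t) :
    IsSuperficial (a * b) (s + t) := by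
  obtain ⟨ha, N, hN⟩ := ha
  obtain ⟨hb, P, hP⟩ := hb
  refine ⟨pow_add (IsLocalRing.maximalIdeal A) s t ▸ Ideal.mul_mem_mul ha hb, N + P,
    fun n hn => ?_⟩
  rw [← Ideal.span_singleton_mul_span_singleton, mul_assoc, ← hP n (by omega),
    ← hN (n + t) (by omega)]
  congr 1
  omega

theorem isSuperficial_one : IsSuperficial (1 : A) 0 :=
  ⟨by simp, 0, fun n _ => by simp⟩

variable (A) in
/-- The first neighborhood ring of `A`: the subring of the total ring of fractions of `A` formed by
all fractions `b / a` with `a` superficial of degree `s` and `b ∈ m ^ s`, for some `s`. -/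
def firstNeighborhoodRing : Subalgebra A (FractionRing A) where
  carrier := {q | ∃ (s : ℕ) (b : A) (a : nonZeroDivisors A), IsSuperficial (a : A) s ∧
    b ∈ IsLocalRing.maximalIdeal A ^ s ∧ q = IsLocalization.mk' (FractionRing A) b a}
  mul_mem' := by
    rintro _ _ ⟨s, b, a, ha, hb, rfl⟩ ⟨t, d, c, hc, hd, rfl⟩
    exact ⟨s + t, b * d, a * c, ha.mul hc,
      pow_add (IsLocalRing.maximalIdeal A) s t ▸ Ideal.mul_mem_mul hb hd,
      (IsLocalization.mk'_mul _ _ _ _ _).symm⟩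
  add_mem' := by
    rintro _ _ ⟨s, b, a, ha, hb, rfl⟩ ⟨t, d, c, hc, hd, rfl⟩
    refine ⟨s + t, b * c + d * a, a * c, ha.mul hc, ?_, (IsLocalization.mk'_add _ _ _ _).symm⟩
    refine add_mem (pow_add (IsLocalRing.maximalIdeal A) s t ▸ Ideal.mul_mem_mul hb hc.1) ?_
    rw [add_comm s t]
    exact pow_add (IsLocalRing.maximalIdeal A) t s ▸ Ideal.mul_mem_mul hd ha.1
  algebraMap_mem' b := ⟨0, b, 1, isSuperficial_one, by simp, (IsLocalization.mk'_one _ b).symm⟩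

variable (A) in
/-- The `A`-submodule `A + m ^ i A'` of the total ring of fractions, `A'` being the first
neighborhood ring. -/
def neighborhoodFiltration (i : ℕ) : Submodule A (FractionRing A) :=
  (1 : Submodule A (FractionRing A)) ⊔
    IsLocalRing.maximalIdeal A ^ i • Subalgebra.toSubmodule (firstNeighborhoodRing A)

variable (A) in
/-- The micro-invariants of `A`: `β_0 = 1` and, for `i ≥ 1`,
`β_i = λ((A + m ^ (i-1) A') / (A + m ^ i A')) - λ((A + m ^ i A') / (A + m ^ (i+1) A'))`. -/
def microInvariant : ℕ → ℤ
  | 0 => 1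
  | i + 1 =>
    ((neighborhoodFiltration A (i + 1)).relLength (neighborhoodFiltration A i) : ℤ) -
      ((neighborhoodFiltration A (i + 2)).relLength (neighborhoodFiltration A (i + 1)) : ℤ)

/-- The Apery invariants of `A` with respect to `x`: `γ_i = λ((m ^ i + xA) / (m ^ (i+1) + xA))`. -/
def aperyInvariant (x : A) (i : ℕ) : ℕ :=
  Submodule.relLength (IsLocalRing.maximalIdeal A ^ (i + 1) ⊔ Ideal.span {x})
    (IsLocalRing.maximalIdeal A ^ i ⊔ Ideal.span {x})

variable (A) in
/-- The minimal number of generators `μ(m ^ i)`. -/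
def muPow (i : ℕ) : ℕ := (IsLocalRing.maximalIdeal A ^ i).spanFinrank

end Invariants

end

/-! Write m for the maximal ideal, k for the residue field, μ(I) for the minimal number of
generators, and x* for the class of x in degree one of G(m). Since xA is a reduction and A has a
regular element in m, x is a nonzerodivisor. Each of the three conditions forces x* to be a
nonzerodivisor on G(m). This suffices: G(m) is finite over k[X] through X ↦ x*, because m ^ (r + i)
= x ^ i m ^ r, and every nonzero polynomial then acts injectively
(`isCohenMacaulayRing_of_finite_of_torsionFree`).

For the Apery and micro-invariants the tool is a count of lengths. The ideal m ^ (t + j) ∩ x ^ t A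
contains x ^ t m ^ j, and the successive quotients of the chain x ^ t m ^ j have length μ(m ^ j). If
the chain of intersections has the same layers for j < r, the two chains agree for j ≤ r
(`inf_eq_of_relELength_eq`), which gives m ^ (n + 1) : x = m ^ n for every n (`mem_pow_of_mul_mem`).
Cutting m ^ i / m ^ (i + 1) by x ^ t A splits μ(m ^ i) into an intersection layer and a sum layer.
The Apery invariants are the sum layers for t = 1. Since x ^ r A' = m ^ r, the micro-invariants are
differences of consecutive sum layers for t = r.

For the tangent cone invariants, count generators: in degree n the decomposition needs at least α_0
+ ... + α_n plus the number of torsion generators of degree n, while the available dimension is μ(m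
^ n). The hypothesis and α_0 ≥ 1 leave no room for torsion, so G(m) is free over F(x). -/

/-! ### Cohen–Macaulayness from finiteness and torsion-freeness over k[X] -/

noncomputable section

open Polynomial in
-- Integrality bounds the dimension by that of k[X]. A maximal ideal of G contracts to a maximal,
-- hence nonzero, ideal of k[X], so it contains the image of some f ≠ 0. That image stays regular
-- after localization: it is a regular sequence of length one and forces the local dimension to be
-- at least 1.
theorem isCohenMacaulayRing_of_finite_of_torsionFree {k G : Type*} [Field k] [CommRing G]
    [Algebra k[X] G] [Module.Finite k[X] G]
    (htf : ∀ f : k[X], f ≠ 0 → algebraMap k[X] G f ∈ nonZeroDivisors G) :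
    IsCohenMacaulayRing G := by
  have hN : IsNoetherianRing G := isNoetherian_of_tower k[X] inferInstance
  have hdim : ringKrullDim G ≤ 1 := by
    rw [← IsPrincipalIdealRing.ringKrullDim_eq_one k[X] (Polynomial.not_isField k)]
    refine Order.krullDim_le_of_strictMono
      (fun p : PrimeSpectrum G => PrimeSpectrum.comap (algebraMap k[X] G) p) ?_
    intro p q hpq
    exact Ideal.IsIntegral.comap_lt_comap hpq
  refine ⟨hN, fun p hp => ⟨inferInstance, ?_⟩⟩
  have hmax := Ideal.isMaximal_comap_of_isIntegral_of_isMaximal (R := k[X]) p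
  obtain ⟨f, hfp, hf0⟩ := Submodule.exists_mem_ne_zero_of_ne_bot
    (Ring.ne_bot_of_isMaximal_of_not_isField hmax (Polynomial.not_isField k))
  set g : G := algebraMap k[X] G f
  have hg : g ∈ nonZeroDivisors G := htf f hf0
  have hgp : g ∈ p := hfp
  set y : Localization.AtPrime p := algebraMap G _ g
  have hy : y ∈ nonZeroDivisors (Localization.AtPrime p) :=
    IsLocalization.map_nonZeroDivisors_le p.primeCompl _ (Submonoid.mem_map_of_mem _ hg)
  have hym : y ∈ IsLocalRing.maximalIdeal (Localization.AtPrime p) :=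
    (IsLocalization.AtPrime.to_map_mem_maximal_iff _ p g).2 hgp
  refine ⟨[y], by simpa using hym, ?_, ?_⟩
  · refine RingTheory.Sequence.IsRegular.of_isWeaklyRegular_of_mem_maximalIdeal _
      (by simpa using hym) ?_
    rw [RingTheory.Sequence.isWeaklyRegular_singleton_iff]
    exact Module.Flat.isSMulRegular_of_nonZeroDivisors hy
  · refine le_antisymm ?_ ?_
    · refine le_trans ?_ (ringKrullDim_quotient_succ_le_of_nonZeroDivisor hy)
      have : Nontrivial (Localization.AtPrime p ⧸ Ideal.span {y}) := by
        refine Ideal.Quotient.nontrivial_iff.mpr fun h => ?_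
        rw [Ideal.span_singleton_eq_top] at h
        exact (IsLocalRing.mem_maximalIdeal _).1 hym h
      have := ringKrullDim_nonneg_of_nontrivial (R := Localization.AtPrime p ⧸ Ideal.span {y})
      simpa using add_le_add_left this 1
    · refine le_trans ?_ hdim
      rw [IsLocalization.AtPrime.ringKrullDim_eq_height p]
      exact Ideal.height_le_ringKrullDim_of_isPrime

end

/-! ### Relative lengths of submodules -/

noncomputable section

namespace Submodule
variable {R M M' : Type*} [CommRing R] [AddCommGroup M] [Module R M] [AddCommGroup M'] [Module R M']

/-- The length of `P / (N ∩ P)`, possibly infinite. -/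
def relELength (N P : Submodule R M) : ℕ∞ := Module.length R (P ⧸ N.submoduleOf P)

theorem relLength_eq_toNat (N P : Submodule R M) : N.relLength P = (N.relELength P).toNat := rfl

theorem relELength_eq_zero_iff {N P : Submodule R M} : N.relELength P = 0 ↔ P ≤ N := by
  rw [relELength, Module.length_eq_zero_iff, Submodule.Quotient.subsingleton_iff,
    submoduleOf_eq_top]

theorem relELength_add {N P Q : Submodule R M} (hNP : N ≤ P) (hPQ : P ≤ Q) :
    N.relELength Q = N.relELength P + P.relELength Q := by
  refine Module.length_eq_add_of_exact
    (Submodule.mapQ _ _ (Submodule.inclusion hPQ) (fun _ h => h))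
    (Submodule.mapQ _ _ LinearMap.id (fun _ h => hNP h)) ?_ ?_ ?_
  · rw [← LinearMap.ker_eq_bot, LinearMap.ker_eq_bot']
    intro a ha
    obtain ⟨a, rfl⟩ := Submodule.mkQ_surjective _ a
    exact (Submodule.Quotient.mk_eq_zero _).2 ((Submodule.Quotient.mk_eq_zero (N.submoduleOf Q)).1 ha)
  · intro a
    obtain ⟨a, rfl⟩ := Submodule.mkQ_surjective _ a
    exact ⟨Submodule.mkQ _ a, rfl⟩
  · intro a
    obtain ⟨a, rfl⟩ := Submodule.mkQ_surjective _ a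
    constructor
    · intro ha
      exact ⟨Submodule.mkQ _ ⟨a, (Submodule.Quotient.mk_eq_zero (P.submoduleOf Q)).1 ha⟩, rfl⟩
    · rintro ⟨b, hb⟩
      obtain ⟨b, rfl⟩ := Submodule.mkQ_surjective _ b
      rw [← hb]
      exact (Submodule.Quotient.mk_eq_zero _).2 b.2

/-- The sequence 0 → (P ∩ K)/(N ∩ K) → P/N → (P + K)/(N + K) → 0 is exact; exactness in the middle
is the modular law for N ≤ P. -/
theorem relELength_sup_inf {N P : Submodule R M} (K : Submodule R M) (h : N ≤ P) :
    N.relELength P = (N ⊓ K).relELength (P ⊓ K) + (N ⊔ K).relELength (P ⊔ K) := by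
  refine Module.length_eq_add_of_exact
    (Submodule.mapQ _ _ (Submodule.inclusion inf_le_left) (fun _ h => h.1))
    (Submodule.mapQ _ _ (Submodule.inclusion le_sup_left) (fun _ h => le_sup_left (a := N) h))
    ?_ ?_ ?_
  · rw [← LinearMap.ker_eq_bot, LinearMap.ker_eq_bot']
    intro a ha
    obtain ⟨a, rfl⟩ := Submodule.mkQ_surjective _ a
    exact (Submodule.Quotient.mk_eq_zero _).2
      ⟨(Submodule.Quotient.mk_eq_zero (N.submoduleOf P)).1 ha, a.2.2⟩
  · intro a
    obtain ⟨⟨a, ha⟩, rfl⟩ := Submodule.mkQ_surjective _ a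
    obtain ⟨p, hp, q, hq, rfl⟩ := Submodule.mem_sup.1 ha
    refine ⟨Submodule.mkQ _ ⟨p, hp⟩, (Submodule.Quotient.eq _).2 ?_⟩
    refine le_sup_right (a := N) (b := K) ?_
    simpa using hq
  · intro a
    obtain ⟨⟨a, ha⟩, rfl⟩ := Submodule.mkQ_surjective _ a
    constructor
    · intro h0
      have h1 : a ∈ N ⊔ K := 
        (Submodule.Quotient.mk_eq_zero ((N ⊔ K).submoduleOf (P ⊔ K))).1 h0
      obtain ⟨p, hp, q, hq, rfl⟩ := Submodule.mem_sup.1 h1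
      have hqP : q ∈ P := by simpa using sub_mem ha (h hp)
      refine ⟨Submodule.mkQ _ ⟨q, hqP, hq⟩, (Submodule.Quotient.eq _).2 ?_⟩
      change q - (p + q) ∈ N
      simpa using hp
    · rintro ⟨b, hb⟩
      obtain ⟨b, rfl⟩ := Submodule.mkQ_surjective _ b
      rw [← hb]
      exact (Submodule.Quotient.mk_eq_zero _).2 (le_sup_right (a := N) b.2.2)

theorem relELength_map {f : M →ₗ[R] M'} (hf : Function.Injective f) (N P : Submodule R M) :
    (N.map f).relELength (P.map f) = N.relELength P := by
  refine (LinearEquiv.length_eq (Submodule.Quotient.equiv _ _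
    (Submodule.equivMapOfInjective f hf P) ?_)).symm
  ext ⟨a, b, hb, rfl⟩
  constructor
  · rintro ⟨c, hc, h⟩
    exact ⟨c, hc, congrArg Subtype.val h⟩
  · rintro ⟨c, hc, h⟩
    obtain rfl := hf h
    exact ⟨⟨c, hb⟩, hc, rfl⟩

theorem eq_of_relELength_eq {N N' P : Submodule R M} (h : N ≤ N') (h' : N' ≤ P)
    (hfin : N'.relELength P ≠ ⊤) (heq : N.relELength P = N'.relELength P) : N = N' := by
  rw [relELength_add h h'] at heq
  refine le_antisymm h (relELength_eq_zero_iff.1 ?_)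
  generalize N.relELength N' = a, N'.relELength P = b at *
  cases b with
  | top => exact absurd rfl hfin
  | coe b =>
    cases a with
    | top => simp at heq
    | coe a => norm_cast at *; omega

end Submodule

open IsLocalRing in
-- By Nakayama, μ(N) is the dimension of N/mN over the residue field, and length over R agrees with
-- that dimension.
theorem IsLocalRing.relELength_smul_eq_spanFinrank {R M : Type*} [CommRing R] [IsLocalRing R]
    [AddCommGroup M] [Module R M] (N : Submodule R M) (hN : N.FG) :
    (maximalIdeal R • N).relELength N = N.spanFinrank := by
  have : Module.Finite R N := Module.Finite.iff_fg.mpr hN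
  have h : (maximalIdeal R • N).submoduleOf N = maximalIdeal R • (⊤ : Submodule R N) := by
    apply Submodule.map_injective_of_injective N.injective_subtype
    rw [Submodule.map_smul'', Submodule.map_top, Submodule.range_subtype,
      Submodule.submoduleOf, Submodule.map_comap_subtype, inf_eq_right]
    exact Submodule.smul_le_right
  rw [Submodule.relELength, h, spanFinrank_eq_finrank_quotient N hN]
  let := Ideal.Quotient.field (maximalIdeal R)
  have : Module.Finite (R ⧸ maximalIdeal R) (N ⧸ maximalIdeal R • (⊤ : Submodule R N)) :=
    Module.Finite.of_restrictScalars_finite R _ _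
  rw [Module.length_eq_of_surjective (R := R ⧸ maximalIdeal R) Ideal.Quotient.mk_surjective]
  exact Module.length_eq_finrank _ _

end

/-! ### Powers of the maximal ideal, Apery invariants and micro-invariants -/

noncomputable section

open IsLocalRing

section PowersOfMaximalIdeal

variable {A : Type*} [CommRing A] [IsLocalRing A]

/-- A regular y ∈ m has y ^ (n + 1) ∈ m ^ (n + 1) ⊆ xA, so x divides a nonzerodivisor. -/
theorem IsCohenMacaulayLocalRing.mem_nonZeroDivisors_of_isReductionOf
    (hCM : IsCohenMacaulayLocalRing A) (hdim : ringKrullDim A = 1) {x : A}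
    (hx : (Ideal.span {x}).IsReductionOf (maximalIdeal A)) : x ∈ nonZeroDivisors A := by
  obtain ⟨-, rs, hmem, hreg, hlen⟩ := hCM
  rw [hdim] at hlen
  have hlen : rs.length = 1 := by exact_mod_cast hlen
  obtain ⟨y, rfl⟩ := List.length_eq_one_iff.1 hlen
  have hy : y ∈ nonZeroDivisors A := by
    have h := (RingTheory.Sequence.isWeaklyRegular_singleton_iff _ _).1 hreg.1
    exact mem_nonZeroDivisors_iff_left.2 fun z hz => h.right_eq_zero_of_smul hz
  obtain ⟨-, n, hn⟩ := hx
  have h1 : y ^ (n + 1) ∈ Ideal.span {x} :=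
    Ideal.mul_le_left (hn ▸ Ideal.pow_mem_pow (hmem y (by simp)) (n + 1))
  obtain ⟨a, ha⟩ := Ideal.mem_span_singleton.1 h1
  exact (mul_mem_nonZeroDivisors.1 (ha ▸ pow_mem hy (n + 1))).1

/-- `A` is Noetherian and its maximal ideal `m` satisfies `m ^ (r + 1) = x m ^ r` for the
nonzerodivisor `x ∈ m`. -/
structure IsStableFrom (x : A) (r : ℕ) : Prop where
  noeth : IsNoetherianRing A
  mem : x ∈ maximalIdeal A
  nzd : x ∈ nonZeroDivisors A
  pow_succ : maximalIdeal A ^ (r + 1) = Ideal.span {x} * maximalIdeal A ^ r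

theorem isStableFrom_redNum (hCM : IsCohenMacaulayLocalRing A) (hdim : ringKrullDim A = 1)
    {x : A} (hx : (Ideal.span {x}).IsReductionOf (maximalIdeal A)) :
    IsStableFrom x (redNum x) where
  noeth := hCM.1
  mem := hx.1 (Ideal.mem_span_singleton_self x)
  nzd := hCM.mem_nonZeroDivisors_of_isReductionOf hdim hx
  pow_succ := Nat.sInf_mem (s := {n : ℕ | maximalIdeal A ^ (n + 1) =
    Ideal.span {x} * maximalIdeal A ^ n}) hx.2

theorem relELength_pow_maximalIdeal [IsNoetherianRing A] (n : ℕ) :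
    (maximalIdeal A ^ (n + 1)).relELength (maximalIdeal A ^ n) = muPow A n := by
  rw [pow_succ', muPow, ← relELength_smul_eq_spanFinrank _ (IsNoetherian.noetherian _)]
  rfl

omit [IsLocalRing A] in
theorem relELength_span_singleton_mul {c : A} (hc : c ∈ nonZeroDivisors A) (I J : Ideal A) :
    (Ideal.span {c} * I).relELength (Ideal.span {c} * J) = I.relELength J := by
  have h (I : Ideal A) : Ideal.span {c} * I = Submodule.map (LinearMap.mulLeft A c) I := by
    ext a
    simp [Ideal.mem_span_singleton_mul]
  rw [h, h, Submodule.relELength_map]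
  intro a b hab
  exact (mul_cancel_left_mem_nonZeroDivisors hc).1 hab

namespace IsStableFrom

variable {x : A} {r : ℕ} (hs : IsStableFrom x r)
include hs

theorem pow_nzd (i : ℕ) : x ^ i ∈ nonZeroDivisors A := pow_mem hs.nzd i

theorem pow_add_eq {n : ℕ} (hn : r ≤ n) (i : ℕ) :
    maximalIdeal A ^ (n + i) = Ideal.span {x ^ i} * maximalIdeal A ^ n := by
  have h1 : maximalIdeal A ^ (n + 1) = Ideal.span {x} * maximalIdeal A ^ n := by
    obtain ⟨k, rfl⟩ := Nat.exists_eq_add_of_le hn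
    rw [add_right_comm, pow_add, hs.pow_succ, mul_assoc, ← pow_add]
  induction i with
  | zero => simp
  | succ i ih =>
    rw [← add_assoc, _root_.pow_succ, ih, mul_assoc, ← _root_.pow_succ, h1, ← mul_assoc,
      Ideal.span_singleton_mul_span_singleton, _root_.pow_succ]

theorem pow_ne_bot (i : ℕ) : maximalIdeal A ^ i ≠ ⊥ := by
  intro h
  have h1 : x ^ i ∈ maximalIdeal A ^ i := Ideal.pow_mem_pow hs.mem i
  rw [h, Ideal.mem_bot] at h1
  exact nonZeroDivisors.ne_zero (hs.pow_nzd i) h1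

theorem span_pow_mul_le (t j : ℕ) :
    Ideal.span {x ^ t} * maximalIdeal A ^ j ≤ maximalIdeal A ^ (t + j) ⊓ Ideal.span {x ^ t} := by
  refine le_inf ?_ Ideal.mul_le_left
  rw [pow_add]
  exact Ideal.mul_mono_left
    ((Ideal.span_singleton_le_iff_mem _).2 (Ideal.pow_mem_pow hs.mem t))

/-- Induction on j: once the chains agree at j, both candidates at j + 1 lie in x ^ t m ^ j with the
same finite colength μ(m ^ j), and one contains the other. -/
theorem inf_eq_of_relELength_eq {t s : ℕ}
    (h : ∀ j < s, (maximalIdeal A ^ (t + (j + 1)) ⊓ Ideal.span {x ^ t}).relELength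
      (maximalIdeal A ^ (t + j) ⊓ Ideal.span {x ^ t}) = muPow A j) :
    ∀ j ≤ s, maximalIdeal A ^ (t + j) ⊓ Ideal.span {x ^ t} =
      Ideal.span {x ^ t} * maximalIdeal A ^ j := by
  have := hs.noeth
  intro j
  induction j with
  | zero =>
    intro _
    refine le_antisymm ?_ (hs.span_pow_mul_le t 0)
    simp
  | succ j ih =>
    intro hj
    have hj' := h j hj
    rw [ih (by omega)] at hj'
    refine (Submodule.eq_of_relELength_eq (hs.span_pow_mul_le t (j + 1))
      (P := Ideal.span {x ^ t} * maximalIdeal A ^ j) ?_ ?_ ?_).symm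
    · rw [← ih (by omega)]
      exact inf_le_inf_right _ (Ideal.pow_le_pow_right (by omega))
    · rw [hj']; exact ENat.natCast_ne_top _
    · rw [hj', relELength_span_singleton_mul (hs.pow_nzd t), relELength_pow_maximalIdeal]

/-- If `x ^ t A ∩ m ^ (t + j) = x ^ t m ^ j` for `j ≤ r`, then `m ^ (n + 1) : x = m ^ n` for
all `n`. -/
theorem mem_pow_of_mul_mem {t : ℕ} (ht : 1 ≤ t)
    (h : ∀ j ≤ r, maximalIdeal A ^ (t + j) ⊓ Ideal.span {x ^ t} =
      Ideal.span {x ^ t} * maximalIdeal A ^ j) (n : ℕ) (a : A)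
    (ha : x * a ∈ maximalIdeal A ^ (n + 1)) : a ∈ maximalIdeal A ^ n := by
  rcases le_total n r with hn | hn
  · have h1 : x ^ t * a ∈ maximalIdeal A ^ (t + n) ⊓ Ideal.span {x ^ t} := by
      refine ⟨?_, Ideal.mem_span_singleton.2 (dvd_mul_right _ _)⟩
      -- Multiplying x * a ∈ m ^ (n + 1) by the remaining t - 1 factors x lands in m ^ (t + n).
      obtain ⟨t, rfl⟩ := Nat.exists_eq_add_of_le' ht
      rw [_root_.pow_succ, mul_assoc, add_assoc, add_comm 1, pow_add]
      exact Ideal.mul_mem_mul (Ideal.pow_mem_pow hs.mem t) ha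
    rw [h n hn, Ideal.mem_span_singleton_mul] at h1
    obtain ⟨b, hb, hab⟩ := h1
    rwa [← (mul_cancel_left_mem_nonZeroDivisors (hs.pow_nzd t)).1 hab]
  · rw [hs.pow_add_eq hn 1, pow_one, Ideal.mem_span_singleton_mul] at ha
    obtain ⟨b, hb, hab⟩ := ha
    rwa [← (mul_cancel_left_mem_nonZeroDivisors hs.nzd).1 hab]

theorem relELength_sup_add (t i : ℕ) :
    (maximalIdeal A ^ (i + 1) ⊓ Ideal.span {x ^ t}).relELength
        (maximalIdeal A ^ i ⊓ Ideal.span {x ^ t}) +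
      (maximalIdeal A ^ (i + 1) ⊔ Ideal.span {x ^ t}).relELength
        (maximalIdeal A ^ i ⊔ Ideal.span {x ^ t}) = muPow A i := by
  have := hs.noeth
  rw [← relELength_pow_maximalIdeal]
  exact (Submodule.relELength_sup_inf _ (Ideal.pow_le_pow_right (by omega))).symm

theorem muPow_add (i : ℕ) : muPow A (r + i) = muPow A r := by
  have := hs.noeth
  have h : (muPow A (r + i) : ℕ∞) = muPow A r := by
    rw [← relELength_pow_maximalIdeal, ← relELength_pow_maximalIdeal, add_right_comm,
      hs.pow_add_eq (by omega) i, hs.pow_add_eq le_rfl i,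
      relELength_span_singleton_mul (hs.pow_nzd i)]
  exact_mod_cast h

theorem mem_pow_of_aperyInvariant (h : ∀ i, 1 ≤ i → i ≤ r →
      (aperyInvariant x i : ℤ) = (muPow A i : ℤ) - (muPow A (i - 1) : ℤ)) (n : ℕ) (a : A)
    (ha : x * a ∈ maximalIdeal A ^ (n + 1)) : a ∈ maximalIdeal A ^ n := by
  refine hs.mem_pow_of_mul_mem le_rfl (hs.inf_eq_of_relELength_eq fun j hj => ?_) n a ha
  have h1 := hs.relELength_sup_add 1 (1 + j)
  have h2 := h (1 + j) (by omega) (by omega)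
  rw [aperyInvariant, Submodule.relLength_eq_toNat] at h2
  rw [pow_one] at *
  rw [← add_assoc]
  -- The two layers add up to a natural number, so both are finite and `toNat` loses nothing.
  generalize (maximalIdeal A ^ (1 + j + 1) ⊓ Ideal.span {x}).relELength
    (maximalIdeal A ^ (1 + j) ⊓ Ideal.span {x}) = u, (maximalIdeal A ^ (1 + j + 1) ⊔
    Ideal.span {x}).relELength (maximalIdeal A ^ (1 + j) ⊔ Ideal.span {x}) = v at *
  cases u with
  | top => simp at h1
  | coe u =>
    cases v with
    | top => simp at h1
    | coe v =>
      have h1 : u + v = muPow A (1 + j) := by exact_mod_cast h1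
      have h2 : (v : ℤ) = muPow A (1 + j) - muPow A j := by simpa using h2
      have h3 : u = muPow A j := by omega
      exact_mod_cast h3

/-- The point is that x ^ r ∉ m ^ (r + 1). Otherwise x ^ r m ^ r ⊆ m ^ (2r + 1) = x ^ r m ^ (r + 1),
so m ^ r = m ^ (r + 1), and Nakayama gives m ^ r = 0. This supplies the initial layer for the
micro-invariants. -/
theorem pow_succ_inf_span_pow :
    maximalIdeal A ^ (r + 1) ⊓ Ideal.span {x ^ r} = Ideal.span {x ^ r} * maximalIdeal A := by
  have := hs.noeth
  refine le_antisymm ?_ ?_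
  · rintro _ ⟨h1, h2⟩
    obtain ⟨a, rfl⟩ := Ideal.mem_span_singleton.1 h2
    refine Ideal.mem_span_singleton_mul.2 ⟨a, ?_, rfl⟩
    rw [mem_maximalIdeal, mem_nonunits_iff]
    intro ha
    have h3 : x ^ r ∈ maximalIdeal A ^ (r + 1) := (Ideal.mul_unit_mem_iff_mem _ ha).1 h1
    have h4 : maximalIdeal A ^ r ≤ maximalIdeal A * maximalIdeal A ^ r := by
      intro b hb
      have h5 : x ^ r * b ∈ Ideal.span {x ^ r} * maximalIdeal A ^ (r + 1) := by
        rw [← hs.pow_add_eq (by omega), pow_add]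
        exact Ideal.mul_mem_mul h3 hb
      obtain ⟨c, hc, hbc⟩ := Ideal.mem_span_singleton_mul.1 h5
      rw [← (mul_cancel_left_mem_nonZeroDivisors (hs.pow_nzd r)).1 hbc, ← _root_.pow_succ']
      exact hc
    refine hs.pow_ne_bot r (Submodule.eq_bot_of_le_smul_of_le_jacobson_bot (maximalIdeal A) _
      (IsNoetherian.noetherian _) h4 (maximalIdeal_le_jacobson _))
  · simpa using hs.span_pow_mul_le r 1

theorem isSuperficial : IsSuperficial (x ^ r) r :=
  ⟨Ideal.pow_mem_pow hs.mem r, r, fun _ hn => hs.pow_add_eq hn r⟩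

/-- This is x ^ r A' = m ^ r. For b / a with a superficial of degree s and N large, x ^ (r + N) b ∈
m ^ (r + N + s) = a m ^ (r + N) = a x ^ N m ^ r; cancelling x ^ N gives x ^ r b ∈ a m ^ r. -/
theorem map_mulLeft_firstNeighborhoodRing :
    (Subalgebra.toSubmodule (firstNeighborhoodRing A)).map
        (LinearMap.mulLeft A (algebraMap A (FractionRing A) (x ^ r))) =
      Submodule.map (Algebra.linearMap A (FractionRing A)) (maximalIdeal A ^ r) := by
  apply le_antisymm
  · rintro _ ⟨_, ⟨s, b, a, ⟨ha, N, hN⟩, hb, rfl⟩, rfl⟩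
    have h1 : x ^ (r + N) * b ∈ maximalIdeal A ^ (r + N + s) := by
      rw [pow_add _ _ s]
      exact Ideal.mul_mem_mul (Ideal.pow_mem_pow hs.mem _) hb
    rw [hN _ (by omega), hs.pow_add_eq le_rfl N, ← mul_assoc,
      Ideal.span_singleton_mul_span_singleton, Ideal.mem_span_singleton_mul] at h1
    obtain ⟨c, hc, hbc⟩ := h1
    refine ⟨c, hc, ?_⟩
    have h2 : a * c = x ^ r * b := by
      refine (mul_cancel_left_mem_nonZeroDivisors (hs.pow_nzd N)).1 ?_
      rw [← mul_assoc, mul_comm (x ^ N), hbc, pow_add]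
      ring
    rw [LinearMap.mulLeft_apply, IsLocalization.mul_mk'_eq_mk'_of_mul, eq_comm,
      IsLocalization.mk'_eq_iff_eq_mul, ← h2]
    simp [mul_comm]
  · rintro _ ⟨c, hc, rfl⟩
    refine ⟨IsLocalization.mk' _ c (⟨x ^ r, hs.pow_nzd r⟩ : nonZeroDivisors A),
      ⟨r, c, _, hs.isSuperficial, hc, rfl⟩, ?_⟩
    exact IsLocalization.mk'_spec' _ c (⟨x ^ r, hs.pow_nzd r⟩ : nonZeroDivisors A)

/-- Multiplication by x ^ r moves the filtration on fractions into A, where its quotients are the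
sum layers for t = r. -/
theorem map_mulLeft_neighborhoodFiltration (i : ℕ) :
    (neighborhoodFiltration A i).map
        (LinearMap.mulLeft A (algebraMap A (FractionRing A) (x ^ r))) =
      Submodule.map (Algebra.linearMap A (FractionRing A))
        (maximalIdeal A ^ (r + i) ⊔ Ideal.span {x ^ r}) := by
  rw [neighborhoodFiltration, Submodule.map_sup, Submodule.map_smul'',
    hs.map_mulLeft_firstNeighborhoodRing, ← Submodule.map_smul'', Submodule.map_sup, sup_comm,
    smul_eq_mul, ← pow_add, add_comm i]
  congr 1
  rw [Submodule.one_eq_range, ← Submodule.map_top, ← Submodule.map_comp]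
  have : Ideal.span {x ^ r} = Submodule.map (LinearMap.mulLeft A (x ^ r)) ⊤ := by
    ext a
    simp [Ideal.mem_span_singleton, dvd_def, eq_comm]
  rw [this, ← Submodule.map_comp]
  congr 1
  ext
  simp

theorem relLength_neighborhoodFiltration (i : ℕ) :
    (neighborhoodFiltration A (i + 1)).relLength (neighborhoodFiltration A i) =
      ((maximalIdeal A ^ (r + i + 1) ⊔ Ideal.span {x ^ r}).relELength
        (maximalIdeal A ^ (r + i) ⊔ Ideal.span {x ^ r})).toNat := by
  have h1 : Function.Injective
      (LinearMap.mulLeft A (algebraMap A (FractionRing A) (x ^ r))) := by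
    intro a b hab
    exact (IsLocalization.map_units (FractionRing A)
      (⟨x ^ r, hs.pow_nzd r⟩ : nonZeroDivisors A)).mul_left_cancel hab
  have h2 : Function.Injective (Algebra.linearMap A (FractionRing A)) :=
    IsFractionRing.injective A (FractionRing A)
  rw [Submodule.relLength_eq_toNat, ← Submodule.relELength_map h1,
    hs.map_mulLeft_neighborhoodFiltration, hs.map_mulLeft_neighborhoodFiltration,
    Submodule.relELength_map h2]
  rfl

theorem mem_pow_of_microInvariant (h : ∀ i, 1 ≤ i → i ≤ r →
      microInvariant A i = (muPow A i : ℤ) - (muPow A (i - 1) : ℤ)) (n : ℕ) (a : A)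
    (ha : x * a ∈ maximalIdeal A ^ (n + 1)) : a ∈ maximalIdeal A ^ n := by
  have := hs.noeth
  -- The exponent t = r must be positive; if r = 0, take t = 1, and there is no layer to check.
  rcases Nat.eq_zero_or_pos r with hr | hr
  · refine hs.mem_pow_of_mul_mem le_rfl (hs.inf_eq_of_relELength_eq fun j hj => ?_) n a ha
    omega
  set u : ℕ → ℕ∞ := fun j => (maximalIdeal A ^ (r + j + 1) ⊓ Ideal.span {x ^ r}).relELength
    (maximalIdeal A ^ (r + j) ⊓ Ideal.span {x ^ r}) with hu
  set v : ℕ → ℕ∞ := fun j => (maximalIdeal A ^ (r + j + 1) ⊔ Ideal.span {x ^ r}).relELength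
    (maximalIdeal A ^ (r + j) ⊔ Ideal.span {x ^ r}) with hv
  have huv (j : ℕ) : u j + v j = muPow A r := by
    rw [← hs.muPow_add j]
    exact hs.relELength_sup_add r (r + j)
  have huv' (j : ℕ) : (u j).toNat + (v j).toNat = muPow A r := by
    have := huv j
    generalize u j = a, v j = b at *
    cases a with
    | top => simp at this
    | coe a =>
      cases b with
      | top => simp at this
      | coe b => exact_mod_cast this
  have hu0 : u 0 = muPow A 0 := by
    have h0 : maximalIdeal A ^ r ⊓ Ideal.span {x ^ r} = Ideal.span {x ^ r} * maximalIdeal A ^ 0 := by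
      rw [pow_zero, mul_one, inf_eq_right, Ideal.span_singleton_le_iff_mem]
      exact Ideal.pow_mem_pow hs.mem r
    change (maximalIdeal A ^ (r + 1) ⊓ _).relELength (maximalIdeal A ^ r ⊓ _) = _
    rw [hs.pow_succ_inf_span_pow, h0, relELength_span_singleton_mul (hs.pow_nzd r),
      ← relELength_pow_maximalIdeal, zero_add, pow_one]
  -- The sum u j + v j is constant because μ(m ^ (r + j)) = μ(m ^ r). Hence the micro-invariant of
  -- index j + 1, v j - v (j + 1), equals u (j + 1) - u j, and the hypothesis telescopes from u 0 =
  -- μ(m ^ 0).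
  have huj (j : ℕ) (hj : j ≤ r) : (u j).toNat = muPow A j := by
    induction j with
    | zero => rw [hu0]; rfl
    | succ j ih =>
      have h1 := h (j + 1) (by omega) hj
      rw [microInvariant, hs.relLength_neighborhoodFiltration,
        hs.relLength_neighborhoodFiltration] at h1
      have h2 : ((v j).toNat : ℤ) - (v (j + 1)).toNat = muPow A (j + 1) - muPow A j := h1
      have h3 := huv' j
      have h4 := huv' (j + 1)
      have h5 := ih (by omega)
      omega
  refine hs.mem_pow_of_mul_mem hr (fun j hj => hs.inf_eq_of_relELength_eq (s := r)
    (fun j hj => ?_) j hj) n a ha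
  have h1 := huj j hj.le
  have h2 : u j ≠ ⊤ := fun h => by simpa [h] using huv j
  rw [← h1, ENat.natCast_toNat h2]
  rfl

end IsStableFrom
end PowersOfMaximalIdeal

end

/-! ### Arithmetic in the graded rings ⨁ J ^ n / I J ^ n -/

noncomputable section

namespace FiberCone

variable {R : Type*} [CommRing R] {I J : Ideal R}

theorem of_mul_apply_of_lt {i : ℕ} (a : FiberConePiece I J i) (g : FiberCone I J) {n : ℕ}
    (hn : n < i) : (DirectSum.of (FiberConePiece I J) i a * g) n = 0 := by
  induction g using DirectSum.induction_on with
  | zero => rw [mul_zero]; rfl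
  | add g h hg hh => rw [mul_add, DirectSum.add_apply, hg, hh, add_zero]
  | of j b =>
    rw [DirectSum.of_mul_of, DirectSum.of_eq_of_ne]
    omega

theorem of_mul_apply_add {i : ℕ} (a : FiberConePiece I J i) (g : FiberCone I J) (n : ℕ) :
    (DirectSum.of (FiberConePiece I J) i a * g) (i + n) = FiberConePiece.mulMap I J i n a (g n) := by
  induction g using DirectSum.induction_on with
  | zero => rw [mul_zero]; exact (map_zero _).symm
  | add g h hg hh => rw [mul_add, DirectSum.add_apply, hg, hh, DirectSum.add_apply, map_add]
  | of j b =>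
    rw [DirectSum.of_mul_of]
    by_cases h : n = j
    · subst h
      rw [DirectSum.of_eq_same, DirectSum.of_eq_same]
      rfl
    · rw [DirectSum.of_eq_of_ne _ _ _ (by omega), DirectSum.of_eq_of_ne _ _ _ h, map_zero]

theorem of_mk_congr {i j : ℕ} (h : i = j) {a : ↥(J ^ i)} {b : ↥(J ^ j)} (hab : (a : R) = b) :
    DirectSum.of (FiberConePiece I J) i (FiberConePiece.mk I J i a) =
      DirectSum.of (FiberConePiece I J) j (FiberConePiece.mk I J j b) := by
  subst h
  rw [Subtype.ext hab]

variable (I J) in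
/-- The structure homomorphism `R → R / I → ⨁ J ^ n / I J ^ n`. -/
def coeffHom : R →+* FiberCone I J where
  toFun a := DirectSum.of (FiberConePiece I J) 0 (FiberConePiece.mk I J 0 ⟨a, by simp⟩)
  map_one' := rfl
  map_zero' := by
    rw [← map_zero (DirectSum.of (FiberConePiece I J) 0), ← map_zero (FiberConePiece.mk I J 0)]
    rfl
  map_add' a b := by
    rw [← map_add, ← map_add]
    rfl
  map_mul' a b := by
    rw [DirectSum.of_mul_of]
    rfl

theorem coeffHom_apply (a : R) : coeffHom I J a =
    DirectSum.of (FiberConePiece I J) 0 (FiberConePiece.mk I J 0 ⟨a, by simp⟩) := rfl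

theorem coeffHom_eq_zero_iff {a : R} : coeffHom I J a = 0 ↔ a ∈ I := by
  rw [coeffHom_apply, ← map_zero (DirectSum.of (FiberConePiece I J) 0),
    (DirectSum.of_injective 0).eq_iff, FiberConePiece.mk_eq_zero_iff]
  simp

theorem coeffHom_mul_of (a : R) (n : ℕ) (b : FiberConePiece I J n) :
    coeffHom I J a * DirectSum.of (FiberConePiece I J) n b =
      DirectSum.of (FiberConePiece I J) n (a • b) := by
  obtain ⟨b, rfl⟩ := FiberConePiece.mk_surjective I J n b
  rw [coeffHom_apply, DirectSum.of_mul_of, FiberConePiece.gMul_mk, ← map_smul]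
  exact of_mk_congr (zero_add n) rfl

theorem coeffHom_mul_apply (a : R) (g : FiberCone I J) (n : ℕ) :
    (coeffHom I J a * g) n = a • g n := by
  induction g using DirectSum.induction_on with
  | zero => rw [mul_zero]; exact (smul_zero _).symm
  | add g h hg hh => rw [mul_add, DirectSum.add_apply, hg, hh, DirectSum.add_apply, smul_add]
  | of j b =>
    rw [coeffHom_mul_of]
    by_cases h : n = j
    · subst h
      rw [DirectSum.of_eq_same, DirectSum.of_eq_same]
    · rw [DirectSum.of_eq_of_ne _ _ _ h, DirectSum.of_eq_of_ne _ _ _ h, smul_zero]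

variable (I) in
/-- The class in degree one of an element of `J`. -/
def degreeOne (x : J) : FiberCone I J :=
  DirectSum.of (FiberConePiece I J) 1 (FiberConePiece.mk I J 1 ⟨x, by rw [pow_one]; exact x.2⟩)

theorem degreeOne_pow (x : J) (n : ℕ) : degreeOne I x ^ n =
    DirectSum.of (FiberConePiece I J) n
      (FiberConePiece.mk I J n ⟨(x : R) ^ n, Ideal.pow_mem_pow x.2 n⟩) := by
  induction n with
  | zero => rw [pow_zero]; exact of_mk_congr rfl (pow_zero _).symm
  | succ n ih =>
    rw [pow_succ, ih, degreeOne, DirectSum.of_mul_of, FiberConePiece.gMul_mk]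
    exact of_mk_congr rfl (pow_succ _ _).symm

theorem degreeOne_mem_nonZeroDivisors {x : J}
    (h : ∀ n, ∀ b ∈ J ^ n, x * b ∈ I * J ^ (n + 1) → b ∈ I * J ^ n) :
    degreeOne I x ∈ nonZeroDivisors (FiberCone I J) := by
  rw [mem_nonZeroDivisors_iff_left]
  intro g hg
  refine DFinsupp.ext fun n => ?_
  have h1 := of_mul_apply_add (FiberConePiece.mk I J 1 ⟨x, by rw [pow_one]; exact x.2⟩) g n
  change (degreeOne I x * g) (1 + n) = _ at h1
  rw [hg] at h1
  obtain ⟨b, hb⟩ := FiberConePiece.mk_surjective I J n (g n)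
  rw [← hb, FiberConePiece.mulMap_mk] at h1
  rw [← hb]
  refine (FiberConePiece.mk_eq_zero_iff I J n b).2 (h n b b.2 ?_)
  rw [add_comm n 1]
  exact (FiberConePiece.mk_eq_zero_iff I J _ _).1 h1.symm

theorem map_of {K : Ideal R} (h : J ≤ K) (n : ℕ) (a : ↥(J ^ n)) :
    FiberCone.map I h (DirectSum.of _ n (FiberConePiece.mk I J n a)) =
      DirectSum.of _ n (FiberConePiece.mk I K n ⟨a, Ideal.pow_right_mono h n a.2⟩) :=
  DirectSum.toSemiring_of _ _ _ _ _

theorem map_coeffHom {K : Ideal R} (h : J ≤ K) (a : R) :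
    FiberCone.map I h (coeffHom I J a) = coeffHom I K a := map_of h 0 _

theorem map_degreeOne {K : Ideal R} (h : J ≤ K) (x : J) :
    FiberCone.map I h (degreeOne I x) = degreeOne I ⟨x, h x.2⟩ := map_of h 1 _

end FiberCone

end

/-! ### The tangent cone as an algebra over k[X] -/

noncomputable section

open IsLocalRing

section

variable {A : Type*} [CommRing A] [IsLocalRing A]

open Polynomial in
/-- The homomorphism `k[X] → G(m)` that sends `X` to the class of `x` in degree one. -/
def TangentCone.polynomialHom (x : maximalIdeal A) : (ResidueField A)[X] →+* TangentCone A :=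
  Polynomial.eval₂RingHom
    (Ideal.Quotient.lift (maximalIdeal A) (FiberCone.coeffHom (maximalIdeal A) (maximalIdeal A))
      (fun _ ha => FiberCone.coeffHom_eq_zero_iff.2 ha) : ResidueField A →+* TangentCone A)
    (FiberCone.degreeOne (maximalIdeal A) x)

open Polynomial in
theorem TangentCone.polynomialHom_C (x : maximalIdeal A) (a : A) :
    polynomialHom x (C (residue A a)) = FiberCone.coeffHom (maximalIdeal A) (maximalIdeal A) a :=
  eval₂_C _ _

open Polynomial in
theorem TangentCone.polynomialHom_X (x : maximalIdeal A) :
    polynomialHom x X = FiberCone.degreeOne (maximalIdeal A) x :=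
  eval₂_X _ _

open Polynomial in
-- Write f = X ^ e u with constant term c = u(0) ≠ 0. The power of X is regular by hypothesis. If u
-- kills g, solving for the constant term gives g ∈ x* v g with v independent of g, so g is
-- divisible by every power of x* and all its components vanish.
theorem TangentCone.polynomialHom_mem_nonZeroDivisors {x : maximalIdeal A}
    (hx : FiberCone.degreeOne (maximalIdeal A) x ∈ nonZeroDivisors (TangentCone A))
    {f : (ResidueField A)[X]} (hf : f ≠ 0) : polynomialHom x f ∈ nonZeroDivisors (TangentCone A) := by
  obtain ⟨u, hu, hdvd⟩ := Polynomial.exists_eq_pow_rootMultiplicity_mul_and_not_dvd f hf 0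
  rw [map_zero, sub_zero] at hu hdvd
  rw [hu, map_mul, map_pow, polynomialHom_X]
  refine mul_mem (pow_mem hx _) (mem_nonZeroDivisors_iff_left.2 fun g hg => ?_)
  rw [X_dvd_iff] at hdvd
  have h1 : u = X * u.divX + C (u.coeff 0) := (X_mul_divX_add u).symm
  set c := u.coeff 0
  have h2 : g = FiberCone.degreeOne (maximalIdeal A) x *
      (polynomialHom x (-C c⁻¹ * u.divX) * g) := by
    have h3 : X * (-C c⁻¹ * u.divX) = 1 - C c⁻¹ * u := by
      have : C c⁻¹ * C c = (1 : (ResidueField A)[X]) := by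
        rw [← C_mul, inv_mul_cancel₀ hdvd, C_1]
      linear_combination this + C c⁻¹ * h1
    rw [← mul_assoc, ← polynomialHom_X, ← map_mul, h3, map_sub, map_one, map_mul, sub_mul,
      mul_assoc, hg]
    ring
  set v := polynomialHom x (-C c⁻¹ * u.divX)
  have h4 (N : ℕ) : g = FiberCone.degreeOne (maximalIdeal A) x ^ N * (v ^ N * g) := by
    induction N with
    | zero => simp
    | succ N ih =>
      conv_lhs => rw [ih, h2]
      ring
  refine DFinsupp.ext fun n => ?_
  rw [h4 (n + 1), FiberCone.degreeOne_pow]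
  exact FiberCone.of_mul_apply_of_lt _ _ (Nat.lt_succ_self n)

open Polynomial in
-- Generators of m ^ n for n ≤ r suffice, since m ^ (r + i) = x ^ i m ^ r makes higher degrees
-- multiples of degree r.
theorem IsStableFrom.finite_polynomialHom {x : A} {r : ℕ} (hs : IsStableFrom x r) :
    (TangentCone.polynomialHom ⟨x, hs.mem⟩).Finite := by
  have := hs.noeth
  let := (TangentCone.polynomialHom ⟨x, hs.mem⟩).toAlgebra
  have hfin (n : ℕ) : ∃ s : Finset ↥(maximalIdeal A ^ n), 
      Submodule.span A (s : Set ↥(maximalIdeal A ^ n)) = ⊤ :=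
    Module.Finite.fg_top
  choose s hspan using hfin
  let cls (n : ℕ) (b : ↥(maximalIdeal A ^ n)) : TangentCone A :=
    DirectSum.of _ n (FiberConePiece.mk (maximalIdeal A) (maximalIdeal A) n b)
  let S : Set (TangentCone A) := ⋃ n ∈ Set.Iic r, cls n '' (s n)
  have hS : S.Finite := (Set.finite_Iic r).biUnion fun n _ => (s n).finite_toSet.image _
  refine Module.Finite.of_fg_top (Submodule.fg_def.2 ⟨S, hS, ?_⟩)
  have h1 (n : ℕ) (hn : n ≤ r) (b : ↥(maximalIdeal A ^ n)) :
      cls n b ∈ Submodule.span (ResidueField A)[X] S := by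
    have hb : b ∈ Submodule.span A (s n : Set ↥(maximalIdeal A ^ n)) := hspan n ▸ Submodule.mem_top
    induction hb using Submodule.span_induction with
    | mem b hb => exact Submodule.subset_span (Set.mem_biUnion hn ⟨b, hb, rfl⟩)
    | zero => simp only [cls, map_zero]; exact zero_mem _
    | add b c _ _ hb hc => simp only [cls, map_add] at *; exact add_mem hb hc
    | smul a b _ hb =>
      have : cls n (a • b) = (C (residue A a) : (ResidueField A)[X]) • cls n b := by
        rw [Algebra.smul_def, RingHom.algebraMap_toAlgebra, TangentCone.polynomialHom_C,
          FiberCone.coeffHom_mul_of, ← map_smul]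
      rw [this]
      exact Submodule.smul_mem _ _ hb
  have h2 (n : ℕ) (b : ↥(maximalIdeal A ^ n)) :
      cls n b ∈ Submodule.span (ResidueField A)[X] S := by
    rcases le_total n r with hn | hn
    · exact h1 n hn b
    · obtain ⟨i, rfl⟩ := Nat.exists_eq_add_of_le hn
      obtain ⟨c, hc, hbc⟩ := Ideal.mem_span_singleton_mul.1 ((hs.pow_add_eq le_rfl i).le b.2)
      have : cls (r + i) b = (X ^ i : (ResidueField A)[X]) • cls r ⟨c, hc⟩ := by
        rw [Algebra.smul_def, RingHom.algebraMap_toAlgebra, map_pow, TangentCone.polynomialHom_X,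
          FiberCone.degreeOne_pow, DirectSum.of_mul_of, FiberConePiece.gMul_mk]
        exact FiberCone.of_mk_congr (add_comm _ _) hbc.symm
      rw [this]
      exact Submodule.smul_mem _ _ (h1 r le_rfl _)
  refine eq_top_iff.2 fun g _ => ?_
  induction g using DirectSum.induction_on with
  | zero => exact zero_mem _
  | add g h hg hh => exact add_mem (hg trivial) (hh trivial)
  | of n b =>
    obtain ⟨b, rfl⟩ := FiberConePiece.mk_surjective _ _ n b
    exact h2 n b

theorem IsStableFrom.isCohenMacaulayRing_tangentCone {x : A} {r : ℕ} (hs : IsStableFrom x r)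
    (hx : FiberCone.degreeOne (maximalIdeal A) ⟨x, hs.mem⟩ ∈ nonZeroDivisors (TangentCone A)) :
    IsCohenMacaulayRing (TangentCone A) := by
  let := (TangentCone.polynomialHom ⟨x, hs.mem⟩).toAlgebra
  have : Module.Finite _ (TangentCone A) := hs.finite_polynomialHom
  exact isCohenMacaulayRing_of_finite_of_torsionFree
    fun f hf => TangentCone.polynomialHom_mem_nonZeroDivisors hx hf

theorem IsStableFrom.degreeOne_mem_nonZeroDivisors {x : A} {r : ℕ} (hs : IsStableFrom x r)
    (h : ∀ (n : ℕ) (a : A), x * a ∈ maximalIdeal A ^ (n + 1) → a ∈ maximalIdeal A ^ n) :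
    FiberCone.degreeOne (maximalIdeal A) ⟨x, hs.mem⟩ ∈ nonZeroDivisors (TangentCone A) := by
  refine FiberCone.degreeOne_mem_nonZeroDivisors fun n b _ hb => ?_
  rw [← _root_.pow_succ'] at hb ⊢
  exact h _ _ hb

end

end

/-! ### Counting generators in the decomposition of the tangent cone -/

noncomputable section

open IsLocalRing

section

variable {A : Type*} [CommRing A] [IsLocalRing A]

/-- The kernel lies in that of A ^ ι → k ^ ι, so the image of φ surjects onto k ^ ι, which has
length the cardinality of ι. -/
theorem IsLocalRing.card_le_length {M ι : Type*} [AddCommGroup M] [Module A M] [Fintype ι]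
    (φ : (ι → A) →ₗ[A] M) (h : ∀ c, φ c = 0 → ∀ i, c i ∈ maximalIdeal A) :
    (Fintype.card ι : ℕ∞) ≤ Module.length A M := by
  let π : (ι → A) →ₗ[A] (ι → A ⧸ maximalIdeal A) :=
    LinearMap.pi fun i => (maximalIdeal A).mkQ ∘ₗ LinearMap.proj i
  have hπ : Function.Surjective π := fun c => by
    choose d hd using fun i => (maximalIdeal A).mkQ_surjective (c i)
    exact ⟨d, funext hd⟩
  have hker : LinearMap.ker φ ≤ LinearMap.ker π := fun c hc => by
    refine LinearMap.mem_ker.2 (funext fun i => ?_)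
    exact (Submodule.Quotient.mk_eq_zero _).2 (h c hc i)
  have : IsSimpleModule A (A ⧸ maximalIdeal A) :=
    isSimpleModule_iff_quot_maximal.2 ⟨_, inferInstance, ⟨LinearEquiv.refl _ _⟩⟩
  calc (Fintype.card ι : ℕ∞) = Module.length A (ι → A ⧸ maximalIdeal A) := by simp
    _ ≤ Module.length A ((ι → A) ⧸ LinearMap.ker φ) :=
      Module.length_le_of_surjective ((LinearMap.ker φ).liftQ π hker) (fun c => by
        obtain ⟨d, rfl⟩ := hπ c
        exact ⟨Submodule.Quotient.mk d, rfl⟩)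
    _ = Module.length A (LinearMap.range φ) := φ.quotKerEquivRange.length_eq
    _ ≤ Module.length A M := Module.length_le_of_injective _ (Submodule.injective_subtype _)

theorem length_tangentConePiece [IsNoetherianRing A] (n : ℕ) :
    Module.length A (FiberConePiece (maximalIdeal A) (maximalIdeal A) n) = muPow A n := by
  rw [← relELength_pow_maximalIdeal, _root_.pow_succ']
  rfl

theorem muPow_zero : muPow A 0 = 1 := by
  rw [muPow, pow_zero, Ideal.one_eq_top, ← Ideal.span_singleton_one]
  exact Submodule.spanFinrank_singleton one_ne_zero

namespace NoetherNormalization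

variable (x : A)

/-- The element `c (x*) ^ d` of `F(x)`. -/
def monomial (d : ℕ) (c : A) : NoetherNormalization x :=
  DirectSum.of _ d (c • FiberConePiece.mk (maximalIdeal A) (Ideal.span {x}) d
    ⟨x ^ d, Ideal.pow_mem_pow (Ideal.mem_span_singleton_self x) d⟩)

theorem monomial_add (d : ℕ) (b c : A) : monomial x d (b + c) = monomial x d b + monomial x d c := by
  rw [monomial, add_smul, map_add]
  rfl

theorem coeffHom_mul_monomial (d : ℕ) (b c : A) :
    FiberCone.coeffHom _ _ b * monomial x d c = monomial x d (b * c) := by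
  rw [monomial, FiberCone.coeffHom_mul_of, smul_smul]
  rfl

theorem monomial_mem_shiftedPiece (i d : ℕ) (c : A) :
    monomial x d c ∈ shiftedPiece x i (d + i) :=
  fun k hk => DirectSum.of_eq_of_ne _ _ _ (by omega)

variable {x}

theorem mem_of_monomial_apply_eq_zero (hx : x ∈ nonZeroDivisors A) {d : ℕ} {c : A}
    (h : monomial x d c d = 0) : c ∈ maximalIdeal A := by
  rw [monomial, DirectSum.of_eq_same, ← map_smul, FiberConePiece.mk_eq_zero_iff] at h
  have h1 : maximalIdeal A * Ideal.span {x} ^ d = Ideal.span {x ^ d} * maximalIdeal A := by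
    rw [Ideal.span_singleton_pow, mul_comm]
  obtain ⟨b, hb, hbc⟩ := Ideal.mem_span_singleton_mul.1 (h1.le h)
  have : x ^ d * b = x ^ d * c := by rw [hbc]; exact mul_comm _ _
  rwa [← (mul_cancel_left_mem_nonZeroDivisors (pow_mem hx d)).1 this]

/-- Truncation at j ≥ 1 leaves degree zero untouched, so the generator of a torsion summand is
nonzero. -/
theorem apply_zero_of_mem_span_xStar_pow {j : ℕ} (hj : 1 ≤ j) {f : NoetherNormalization x}
    (h : f ∈ Ideal.span {xStar x ^ j}) : f 0 = 0 := by
  obtain ⟨g, rfl⟩ := Ideal.mem_span_singleton.1 h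
  obtain ⟨j, rfl⟩ := Nat.exists_eq_add_of_le' hj
  rw [_root_.pow_succ', mul_assoc]
  exact FiberCone.of_mul_apply_of_lt _ _ zero_lt_one

theorem xStar_mem_nonZeroDivisors (hx : x ∈ nonZeroDivisors A) :
    xStar x ∈ nonZeroDivisors (NoetherNormalization x) := by
  refine FiberCone.degreeOne_mem_nonZeroDivisors
    (x := ⟨x, Ideal.mem_span_singleton_self x⟩) fun n b _ hb => ?_
  rw [_root_.pow_succ', mul_left_comm, Ideal.mem_span_singleton_mul] at hb
  obtain ⟨c, hc, hbc⟩ := hb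
  rwa [← (mul_cancel_left_mem_nonZeroDivisors hx).1 hbc]

end NoetherNormalization

namespace CyclicSum

open NoetherNormalization

instance (r : ℕ) (α : ℕ → ℕ) : Fintype (FreeIndex r α) :=
  haveI : Finite {i : ℕ // i ≤ r} := (Set.finite_Iic r).to_subtype
  Fintype.ofFinite _

instance (r : ℕ) (αt : ℕ → ℕ → ℕ) : Fintype (TorsionIndex r αt) :=
  haveI : Finite {p : ℕ × ℕ // 1 ≤ p.1 ∧ p.1 ≤ r - 1 ∧ 1 ≤ p.2 ∧ p.2 ≤ r - p.1} :=
    ((Set.finite_Iic (r, r)).subset (fun p hp => by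
      obtain ⟨h1, h2, h3, h4⟩ := hp
      exact ⟨by change p.1 ≤ r; omega, by change p.2 ≤ r; omega⟩)).to_subtype
  Fintype.ofFinite _

variable (x : A) (α : ℕ → ℕ) (αt : ℕ → ℕ → ℕ)

/-- Index set of the free generators of degree at most `n` and the torsion generators of
degree `n`. -/
abbrev GeneratorIndex (n : ℕ) : Type :=
  {s : FreeIndex (redNum x) α // s.1.1 ≤ n} ⊕ {t : TorsionIndex (redNum x) αt // t.1.1.1 = n}

open Classical in
/-- The combination with coefficients `c` of the free generators, multiplied by powers of `x*` to have
degree `n`, and of the torsion generators of degree `n`. -/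
def combination (n : ℕ) (c : GeneratorIndex x α αt n → A) : CyclicSum x α αt :=
  (DFinsupp.equivFunOnFintype.symm fun s =>
      if h : s.1.1 ≤ n then monomial x (n - s.1.1) (c (.inl ⟨s, h⟩)) else 0,
    DFinsupp.equivFunOnFintype.symm fun t =>
      Ideal.Quotient.mk _ (if h : t.1.1.1 = n then monomial x 0 (c (.inr ⟨t, h⟩)) else 0))

variable {x α αt}

theorem combination_fst (n : ℕ) (c : GeneratorIndex x α αt n → A)
    (s : {s : FreeIndex (redNum x) α // s.1.1 ≤ n}) :
    (combination x α αt n c).1 s = monomial x (n - s.1.1.1) (c (.inl s)) :=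
  dif_pos s.2

theorem combination_snd (n : ℕ) (c : GeneratorIndex x α αt n → A)
    (t : {t : TorsionIndex (redNum x) αt // t.1.1.1 = n}) :
    (combination x α αt n c).2 t = Ideal.Quotient.mk _ (monomial x 0 (c (.inr t))) :=
  congrArg _ (dif_pos t.2)

theorem ext {v w : CyclicSum x α αt} (h1 : ∀ s, v.1 s = w.1 s) (h2 : ∀ t, v.2 t = w.2 t) : v = w :=
  Prod.ext (DFinsupp.ext h1) (DFinsupp.ext h2)

theorem combination_fst_of_not_le (n : ℕ) (c : GeneratorIndex x α αt n → A)
    {s : FreeIndex (redNum x) α} (hs : ¬ s.1.1 ≤ n) : (combination x α αt n c).1 s = 0 :=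
  dif_neg hs

theorem combination_snd_of_ne (n : ℕ) (c : GeneratorIndex x α αt n → A)
    {t : TorsionIndex (redNum x) αt} (ht : t.1.1.1 ≠ n) : (combination x α αt n c).2 t = 0 :=
  (congrArg (Ideal.Quotient.mk _) (dif_neg ht)).trans (map_zero _)

theorem combination_add (n : ℕ) (b c : GeneratorIndex x α αt n → A) :
    combination x α αt n (b + c) = combination x α αt n b + combination x α αt n c := by
  refine ext (fun s => ?_) fun t => ?_
  · rw [Prod.fst_add, DirectSum.add_apply]
    by_cases h : s.1.1 ≤ n
    · rw [combination_fst n _ ⟨s, h⟩, combination_fst n _ ⟨s, h⟩, combination_fst n _ ⟨s, h⟩,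
        ← monomial_add]
      rfl
    · simp only [combination_fst_of_not_le n _ h, add_zero]
  · rw [Prod.snd_add, DirectSum.add_apply]
    by_cases h : t.1.1.1 = n
    · rw [combination_snd n _ ⟨t, h⟩, combination_snd n _ ⟨t, h⟩, combination_snd n _ ⟨t, h⟩,
        ← map_add, ← monomial_add]
      rfl
    · simp only [combination_snd_of_ne n _ h, add_zero]

theorem combination_smul (n : ℕ) (a : A) (c : GeneratorIndex x α αt n → A) :
    combination x α αt n (a • c) =
      FiberCone.coeffHom (maximalIdeal A) (Ideal.span {x}) a • combination x α αt n c := by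
  refine ext (fun s => ?_) fun t => ?_
  · rw [Prod.smul_fst, DirectSum.smul_apply]
    by_cases h : s.1.1 ≤ n
    · rw [combination_fst n _ ⟨s, h⟩, combination_fst n _ ⟨s, h⟩, smul_eq_mul,
        coeffHom_mul_monomial]
      rfl
    · simp only [combination_fst_of_not_le n _ h, smul_zero]
  · rw [Prod.smul_snd, DirectSum.smul_apply]
    by_cases h : t.1.1.1 = n
    · rw [combination_snd n _ ⟨t, h⟩, combination_snd n _ ⟨t, h⟩, Pi.smul_apply, smul_eq_mul,
        ← coeffHom_mul_monomial]
      rfl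
    · simp only [combination_snd_of_ne n _ h, smul_zero]

theorem combination_mem_piece (n : ℕ) (c : GeneratorIndex x α αt n → A) :
    combination x α αt n c ∈ piece x α αt n := by
  refine ⟨fun s => ?_, fun t => ?_⟩
  · by_cases h : s.1.1 ≤ n
    · rw [combination_fst n c ⟨s, h⟩]
      simpa only [Nat.sub_add_cancel h] using monomial_mem_shiftedPiece x s.1.1 (n - s.1.1) _
    · rw [combination_fst_of_not_le n c h]
      exact fun _ _ => rfl
  · by_cases h : t.1.1.1 = n
    · refine ⟨_, ?_, combination_snd n c ⟨t, h⟩⟩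
      subst h
      simpa only [zero_add] using monomial_mem_shiftedPiece x t.1.1.1 0 (c (.inr ⟨t, rfl⟩))
    · exact ⟨0, fun _ _ => rfl, (combination_snd_of_ne n c h).trans (map_zero _).symm⟩

theorem mem_of_combination_eq_zero (hx : x ∈ nonZeroDivisors A) {n : ℕ}
    {c : GeneratorIndex x α αt n → A} (h : combination x α αt n c = 0) (i) :
    c i ∈ maximalIdeal A := by
  rcases i with s | t
  · have h1 := combination_fst n c s
    rw [h] at h1
    refine mem_of_monomial_apply_eq_zero hx (d := n - s.1.1.1) ?_
    rw [← h1]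
    rfl
  · have h1 := combination_snd n c t
    rw [h] at h1
    exact mem_of_monomial_apply_eq_zero hx (apply_zero_of_mem_span_xStar_pow t.1.1.2.2.2.1
      (Ideal.Quotient.eq_zero_iff_mem.1 h1.symm))

variable {hx : Ideal.span {x} ≤ maximalIdeal A}

/-- The shifted free generators and the torsion generators of degree n are independent modulo m, and
e sends them into degree n of G(m), which has length μ(m ^ n). Torsion of lower degree is ignored,
as a lower bound is enough. -/
theorem card_generatorIndex_le [IsNoetherianRing A] (hnzd : x ∈ nonZeroDivisors A)
    (e : CyclicSum x α αt ≃+ TangentCone A)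
    (hsmul : ∀ (f : NoetherNormalization x) (v : CyclicSum x α αt),
      e (f • v) = FiberCone.map (maximalIdeal A) hx f * e v)
    (hdeg : ∀ n, ∀ v ∈ piece x α αt n, ∀ k, k ≠ n → e v k = 0) (n : ℕ) :
    Nat.card (GeneratorIndex x α αt n) ≤ muPow A n := by
  let := Fintype.ofFinite (GeneratorIndex x α αt n)
  let φ : (GeneratorIndex x α αt n → A) →ₗ[A]
      FiberConePiece (maximalIdeal A) (maximalIdeal A) n :=
    { toFun := fun c => e (combination x α αt n c) n
      map_add' := fun b c => by rw [combination_add, map_add]; rfl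
      map_smul' := fun a c => by
        rw [combination_smul, hsmul, FiberCone.map_coeffHom, FiberCone.coeffHom_mul_apply]
        rfl }
  have h := card_le_length φ fun c hc => by
    refine mem_of_combination_eq_zero hnzd (e.map_eq_zero_iff.1 (DFinsupp.ext fun k => ?_))
    by_cases hk : k = n
    · rw [hk]; exact hc
    · exact hdeg n _ (combination_mem_piece n c) k hk
  rw [length_tangentConePiece, ← Nat.card_eq_fintype_card] at h
  exact_mod_cast h

theorem sum_le_card_freeIndex {r : ℕ} {n : ℕ} (hn : n ≤ r) :
    ∑ i ∈ Finset.range (n + 1), α i ≤ Nat.card {s : FreeIndex r α // s.1.1 ≤ n} := by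
  let f : (Σ i : Fin (n + 1), Fin (α i)) → {s : FreeIndex r α // s.1.1 ≤ n} :=
    fun p => ⟨⟨⟨p.1, by omega⟩, p.2⟩, by simp; omega⟩
  have hf : Function.Injective f := by
    rintro ⟨⟨i, hi⟩, l⟩ ⟨⟨j, hj⟩, l'⟩ h
    simp only [f, Subtype.mk.injEq, Sigma.mk.injEq] at h
    obtain ⟨rfl, h⟩ := h
    rw [eq_of_heq h]
  have h := Nat.card_le_card_of_injective f hf
  rw [Nat.card_eq_fintype_card, Fintype.card_sigma] at h
  simpa [Fin.sum_univ_eq_sum_range] using h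

/-- Torsion summands start in degree at least 1, so without free generators of degree 0 nothing
reaches degree 0 of G(m). Applied to the preimage of 1, this gives α 0 ≠ 0. -/
theorem apply_zero_eq_zero (e : CyclicSum x α αt ≃+ TangentCone A)
    (hdeg : ∀ n, ∀ v ∈ piece x α αt n, ∀ k, k ≠ n → e v k = 0) (hα : α 0 = 0)
    (v : CyclicSum x α αt) : e v 0 = 0 := by
  have hpos (s : FreeIndex (redNum x) α) : 0 < s.1.1 := by
    rcases s with ⟨⟨i, hi⟩, l⟩
    rcases Nat.eq_zero_or_pos i with rfl | h
    · exact absurd l.2 (by simp [hα])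
    · exact h
  have hadd1 (v w : ⨁ _ : FreeIndex (redNum x) α, NoetherNormalization x) :
      e (v + w, 0) = e (v, 0) + e (w, 0) := by rw [← map_add, Prod.mk_add_mk, add_zero]
  have hadd2 (v w : ⨁ s : TorsionIndex (redNum x) αt, Truncation x s.1.1.2) :
      e (0, v + w) = e (0, v) + e (0, w) := by rw [← map_add, Prod.mk_add_mk, add_zero]
  have h1 (w) : e (w, 0) 0 = 0 := by
    induction w using DirectSum.induction_on with
    | zero => exact congrArg (fun g : TangentCone A => g 0) (map_zero e)
    | add v w hv hw =>
      rw [hadd1, DirectSum.add_apply, hv, hw, add_zero]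
    | of s f =>
      induction f using DirectSum.induction_on with
      | zero =>
        rw [map_zero]
        exact congrArg (fun g : TangentCone A => g 0) (map_zero e)
      | add f g hf hg =>
        rw [map_add]
        rw [hadd1, DirectSum.add_apply, hf, hg, add_zero]
      | of k b =>
        refine hdeg (k + s.1.1) _ ⟨fun s' => ?_, fun t => ⟨0, fun _ _ => rfl, rfl⟩⟩ 0
          (by have := hpos s; omega)
        by_cases hs : s' = s
        · subst hs
          dsimp only
          rw [DirectSum.of_eq_same]
          exact fun l hl => DirectSum.of_eq_of_ne _ _ _ (by omega)
        · dsimp only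
          rw [DirectSum.of_eq_of_ne _ _ _ hs]
          exact fun _ _ => rfl
  have h2 (w) : e (0, w) 0 = 0 := by
    induction w using DirectSum.induction_on with
    | zero => exact congrArg (fun g : TangentCone A => g 0) (map_zero e)
    | add v w hv hw =>
      rw [hadd2, DirectSum.add_apply, hv, hw, add_zero]
    | of t f =>
      obtain ⟨f, rfl⟩ := Ideal.Quotient.mk_surjective f
      induction f using DirectSum.induction_on with
      | zero =>
        rw [map_zero, map_zero]
        exact congrArg (fun g : TangentCone A => g 0) (map_zero e)
      | add f g hf hg =>
        rw [map_add, map_add]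
        rw [hadd2, DirectSum.add_apply, hf, hg, add_zero]
      | of k b =>
        refine hdeg (k + t.1.1.1) _ ⟨fun _ _ _ => rfl, fun t' => ?_⟩ 0
          (by have := t.1.2.1; omega)
        by_cases ht : t' = t
        · subst ht
          dsimp only
          rw [DirectSum.of_eq_same]
          exact ⟨_, fun l hl => DirectSum.of_eq_of_ne _ _ _ (by omega), rfl⟩
        · dsimp only
          rw [DirectSum.of_eq_of_ne _ _ _ ht]
          exact ⟨0, fun _ _ => rfl, rfl⟩
  have h3 : e v = e (v.1, 0) + e (0, v.2) := by
    rw [← map_add, Prod.mk_add_mk, add_zero, zero_add]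
  rw [h3, DirectSum.add_apply, h1, h2, add_zero]

end CyclicSum

open CyclicSum in
theorem IsTangentConeInvariants.degreeOne_mem_nonZeroDivisors [IsNoetherianRing A] {x : A}
    {hx : Ideal.span {x} ≤ maximalIdeal A} {α : ℕ → ℕ} {αt : ℕ → ℕ → ℕ}
    (hnzd : x ∈ nonZeroDivisors A) (h : IsTangentConeInvariants x hx α αt)
    (hα : ∀ i, 1 ≤ i → i ≤ redNum x → (α i : ℤ) = (muPow A i : ℤ) - (muPow A (i - 1) : ℤ)) :
    FiberCone.degreeOne (maximalIdeal A) ⟨x, hx (Ideal.mem_span_singleton_self x)⟩ ∈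
      nonZeroDivisors (TangentCone A) := by
  obtain ⟨e, hsmul, hdeg⟩ := h
  -- Telescoping the hypothesis from μ(m ^ 0) = 1; α 0 itself is not prescribed.
  have hsum (n : ℕ) (hn : n ≤ redNum x) :
      ∑ i ∈ Finset.range (n + 1), α i + 1 = α 0 + muPow A n := by
    induction n with
    | zero => simp [muPow_zero]
    | succ n ih =>
      rw [Finset.sum_range_succ]
      have h1 := ih (by omega)
      have h2 := hα (n + 1) (by omega) hn
      rw [Nat.add_sub_cancel] at h2
      omega
  have hα0 : α 0 ≠ 0 := fun h0 => by
    have h1 := apply_zero_eq_zero e hdeg h0 (e.symm 1)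
    rw [e.apply_symm_apply] at h1
    have h2 : (1 : A) ∈ maximalIdeal A * maximalIdeal A ^ 0 :=
      (FiberConePiece.mk_eq_zero_iff _ _ 0 ⟨1, by simp⟩).1 h1
    rw [pow_zero, mul_one] at h2
    exact (maximalIdeal A).ne_top_iff_one.1 (maximalIdeal.isMaximal A).ne_top h2
  -- As α 0 ≥ 1, the free generators of degree at most n already number at least μ(m ^ n), so one
  -- torsion generator of degree n exceeds the bound.
  have hempty : IsEmpty (TorsionIndex (redNum x) αt) := ⟨fun t => by
    have hn : t.1.1.1 ≤ redNum x := by have := t.1.2.2.1; omega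
    have h1 := card_generatorIndex_le hnzd e hsmul hdeg t.1.1.1
    have h2 := sum_le_card_freeIndex (α := α) hn
    have h3 := hsum _ hn
    rw [Nat.card_sum] at h1
    have h4 : 0 < Nat.card {t' : TorsionIndex (redNum x) αt // t'.1.1.1 = t.1.1.1} :=
      Nat.card_pos_iff.2 ⟨⟨⟨t, rfl⟩⟩, inferInstance⟩
    omega⟩
  refine mem_nonZeroDivisors_iff_left.2 fun g hg => ?_
  obtain ⟨v, rfl⟩ := e.surjective g
  have hmap : FiberCone.map (maximalIdeal A) hx (NoetherNormalization.xStar x) =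
      FiberCone.degreeOne (maximalIdeal A) ⟨x, hx (Ideal.mem_span_singleton_self x)⟩ :=
    FiberCone.map_degreeOne hx ⟨x, Ideal.mem_span_singleton_self x⟩
  rw [← hmap, ← hsmul, e.map_eq_zero_iff] at hg
  have hv : v = 0 := CyclicSum.ext (fun s => by
    have h1 : NoetherNormalization.xStar x * v.1 s = 0 :=
      congrArg (fun w : CyclicSum x α αt => w.1 s) hg
    exact mem_nonZeroDivisors_iff_left.1
      (NoetherNormalization.xStar_mem_nonZeroDivisors hnzd) _ h1) fun t => hempty.elim t
  rw [hv, map_zero]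

end

end

theorem mainTheorem8 {A : Type*} [CommRing A] [IsLocalRing A]
    (hCM : IsCohenMacaulayLocalRing A) (hdim : ringKrullDim A = 1)
    (hinf : Infinite (IsLocalRing.ResidueField A))
    (x : A) (hx : (Ideal.span {x}).IsMinimalReductionOf (IsLocalRing.maximalIdeal A))
    (h :
      (∃ (α : ℕ → ℕ) (αt : ℕ → ℕ → ℕ), IsTangentConeInvariants x hx.prop.1 α αt ∧
        ∀ i, 1 ≤ i → i ≤ redNum x → (α i : ℤ) = (muPow A i : ℤ) - (muPow A (i - 1) : ℤ)) ∨
      (∀ i, 1 ≤ i → i ≤ redNum x →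
        microInvariant A i = (muPow A i : ℤ) - (muPow A (i - 1) : ℤ)) ∨
      (∀ i, 1 ≤ i → i ≤ redNum x →
        (aperyInvariant x i : ℤ) = (muPow A i : ℤ) - (muPow A (i - 1) : ℤ))) :
    IsCohenMacaulayRing (TangentCone A) := by 
  have hs := isStableFrom_redNum hCM hdim hx.prop
  have := hs.noeth
  refine hs.isCohenMacaulayRing_tangentCone ?_
  rcases h with ⟨α, αt, hinv, hα⟩ | h | h
  · exact hinv.degreeOne_mem_nonZeroDivisors hs.nzd hα
  · exact hs.degreeOne_mem_nonZeroDivisors (hs.mem_pow_of_microInvariant h)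
  · exact hs.degreeOne_mem_nonZeroDivisors (hs.mem_pow_of_aperyInvariant h)
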